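/- Let $\Gamma$ be a finite group, $\Gamma'\le\Gamma$ a subgroup, and $S$ a set of prime numbers. Let $\mathbb Z_S\subseteq\mathbb Q$ be the localization of $\mathbb Z$ at the nonzero integers not divisible by any prime in $S$, and write $\mathbb Z_{(p)}=\mathbb Z_{\{p\}}$. If $B$ is a finite-dimensional $\mathbb Q$-algebra, a $\mathbb Z_S$-order in $B$ is a subring of $B$ with the same identity that is finitely generated as a $\mathbb Z_S$-module and spans $B$ over $\mathbb Q$; it is maximal if it is not properly contained in another $\mathbb Z_S$-order of $B$. (If $e$ is an idempotent of a ring $A$, then $eAe$ is regarded as a ring with identity $e$.) Let $e_1'=\frac1{|\Gamma'|}\sum_{\tau\in\Gamma'}\tau\in\mathbb Q[\Gamma]$, and let $e_{\Gamma/\Gamma'}$ be the central idempotent of $\mathbb Q[\Gamma]$ associated to the augmentation character $a_{\Gamma/\Gamma'}=\mathrm{Ind}_{\Gamma'}^{\Gamma}1-1$, i.e. the minimal central idempotent that acts as the identity on a $\mathbb Q$-representation with character $a_{\Gamma/\Gamma'}$. Assume that every $p\in S$ is good for $e_{\Gamma/\Gamma'}$, i.e. $e_{\Gamma/\Gamma'}\in\mathbb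 Z_{(p)}[\Gamma]$ and $e_{\Gamma/\Gamma'}\mathbb Z_{(p)}[\Gamma]$ is a maximal $\mathbb Z_{(p)}$-order in $e_{\Gamma/\Gamma'}\mathbb Q[\Gamma]$. Let $\mathcal O\subseteq\mathbb Q[\Gamma]$ be a maximal $\mathbb Z_S$-order containing $\mathbb Z_S[\Gamma]$, and let $$\mathfrak o={}^{\Gamma'}\big(e_{\Gamma/\Gamma'}\mathcal O e_1'\big)=\{x\in e_{\Gamma/\Gamma'}\mathcal O e_1' : \tau x=x\ \text{for all}\ \tau\in\Gamma'\}.$$ Then $\mathfrak o$ is a maximal $\mathbb Z_S$-order in the $\mathbb Q$-algebra $e_1'e_{\Gamma/\Gamma'}\mathbb Q[\Gamma]e_1'$. -/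

import Mathlib

open scoped MonoidAlgebra

noncomputable section

namespace HeckeOrder

/-- The ring `ℤ_S ⊆ ℚ` for a set `S` of primes: the fractions whose (reduced) denominator is not
divisible by any prime in `S`, i.e. the localization of `ℤ` at the nonzero integers that are not
divisible by any prime in `S`. -/
def ZS (S : Set Nat.Primes) : Subring ℚ where
  carrier := {q | ∀ p ∈ S, ¬ (p : ℕ) ∣ q.den}
  mul_mem' {a b} ha hb p hp h :=
    (p.2.dvd_mul.1 (h.trans (Rat.mul_den_dvd a b))).elim (ha p hp) (hb p hp)
  one_mem' p _ := by simpa using p.2.one_lt.ne'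
  add_mem' {a b} ha hb p hp h :=
    (p.2.dvd_mul.1 (h.trans (Rat.add_den_dvd a b))).elim (ha p hp) (hb p hp)
  zero_mem' p _ := by simpa using p.2.one_lt.ne'
  neg_mem' {a} ha p hp := by simpa using ha p hp

section Orders

variable {A : Type*} [Ring A] [Algebra ℚ A]

/-- The `ℚ`-algebra `f A f`. For an idempotent `f` this is an algebra with identity `f`; for
a central idempotent `f` it is `f A`, and for `f = 1` it is `A`. -/
def corner (f : A) : Submodule ℚ A :=
  LinearMap.range (LinearMap.mulLeft ℚ f ∘ₗ LinearMap.mulRight ℚ f)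

/-- `Λ` is an `R`-order in the `ℚ`-algebra `f A f` (`f` an idempotent): a subring of `f A f` with
the same identity `f`, which is a finitely generated `R`-module and spans `f A f` over `ℚ`. -/
structure IsOrder (R : Subring ℚ) (f : A) (Λ : Submodule R A) : Prop where
  le_corner : ∀ x ∈ Λ, x ∈ corner f
  one_mem : f ∈ Λ
  mul_mem : ∀ x ∈ Λ, ∀ y ∈ Λ, x * y ∈ Λ
  fg : Λ.FG
  span_eq : Submodule.span ℚ (Λ : Set A) = corner f

/-- `Λ` is a maximal `R`-order in the `ℚ`-algebra `f A f`: an order that is not properly contained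
in another order. -/
structure IsMaximalOrder (R : Subring ℚ) (f : A) (Λ : Submodule R A) : Prop where
  isOrder : IsOrder R f Λ
  maximal : ∀ Λ' : Submodule R A, IsOrder R f Λ' → Λ ≤ Λ' → Λ' = Λ

end Orders

section Idempotents

variable {Γ : Type*} [Group Γ]

/-- `e` is the minimal central idempotent of `ℚ[Γ]` that acts as the identity on the
representation `ρ`. For idempotents, `e ≤ f` means `e * f = e`. -/
structure IsAssociatedIdempotent {V : Type*} [AddCommGroup V] [Module ℚ V]
    (ρ : Representation ℚ Γ V) (e : ℚ[Γ]) : Prop where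
  central : ∀ x : ℚ[Γ], e * x = x * e
  idem : e * e = e
  acts : ρ.asAlgebraHom e = 1
  minimal : ∀ f : ℚ[Γ], (∀ x : ℚ[Γ], f * x = x * f) → f * f = f →
    ρ.asAlgebraHom f = 1 → e * f = e

theorem exists_isAssociatedIdempotent [Finite Γ] {V : Type*} [AddCommGroup V] [Module ℚ V]
    (ρ : Representation ℚ Γ V) : ∃ e, IsAssociatedIdempotent ρ e := by
  have hne : {N : Submodule ℚ ℚ[Γ] | ∃ f : ℚ[Γ], (∀ x : ℚ[Γ], f * x = x * f) ∧ f * f = f ∧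
      ρ.asAlgebraHom f = 1 ∧ N = LinearMap.range (LinearMap.mulLeft ℚ f)}.Nonempty :=
    ⟨_, 1, by simp, by simp, by simp, rfl⟩
  obtain ⟨N, ⟨e, hc, hi, ha, rfl⟩, hmin⟩ := IsArtinian.set_has_minimal _ hne
  refine ⟨e, hc, hi, ha, fun f fc fi fa => ?_⟩
  have hle : LinearMap.range (LinearMap.mulLeft ℚ (e * f)) ≤
      LinearMap.range (LinearMap.mulLeft ℚ e) := by
    rintro _ ⟨x, rfl⟩
    exact ⟨f * x, by simp⟩
  have hnlt := hmin _ ⟨e * f, fun x => by rw [mul_assoc, fc, ← mul_assoc, hc, mul_assoc],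
    by rw [mul_assoc, ← mul_assoc f, fc e, mul_assoc, fi, ← mul_assoc, hi],
    by rw [map_mul, ha, fa, one_mul], rfl⟩
  have heq := eq_of_le_of_not_lt hle hnlt
  obtain ⟨y, hy⟩ : e ∈ LinearMap.range (LinearMap.mulLeft ℚ (e * f)) := by
    rw [heq]; exact ⟨1, by simp⟩
  simp only [LinearMap.mulLeft_apply] at hy
  rw [← fc, ← hy, ← mul_assoc, ← mul_assoc f e f, fc e, mul_assoc e f f, fi]

/-- The augmentation representation of `Γ` on the elements of `ℚ[Γ/Γ']` with coefficient sum `0`.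
Since `ℚ[Γ/Γ']` is the sum of this representation and the trivial one, its character is
`Ind_{Γ'}^Γ 1 - 1`. -/
def augmentationSub [Finite Γ] (Γ' : Subgroup Γ) :
    Subrepresentation (Representation.ofMulAction ℚ Γ (Γ ⧸ Γ')) where
  toSubmodule := LinearMap.ker
    (Finsupp.linearCombination ℚ (fun _ : Γ ⧸ Γ' => (1 : ℚ)) ∘ₗ
      (MonoidAlgebra.coeffLinearEquiv (S := ℚ) (M := Γ ⧸ Γ') ℚ).toLinearMap)
  apply_mem_toSubmodule g v hv := by
    rw [LinearMap.mem_ker] at hv ⊢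
    rw [← hv]
    simp [Representation.ofMulAction_def, Finsupp.linearCombination_mapDomain, Function.comp_def]

/-- The representation of `Γ` on the augmentation subspace of `ℚ[Γ/Γ']`. -/
def augmentationRep [Finite Γ] (Γ' : Subgroup Γ) :
    Representation ℚ Γ (augmentationSub Γ').toSubmodule :=
  (augmentationSub Γ').toRepresentation

/-- The central idempotent `e_{Γ/Γ'}` of `ℚ[Γ]` associated to the augmentation character
`Ind_{Γ'}^Γ 1 - 1`. -/
def augIdem [Finite Γ] (Γ' : Subgroup Γ) : ℚ[Γ] :=
  (exists_isAssociatedIdempotent (augmentationRep Γ')).choose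

theorem augIdem_spec [Finite Γ] (Γ' : Subgroup Γ) :
    IsAssociatedIdempotent (augmentationRep Γ') (augIdem Γ') :=
  (exists_isAssociatedIdempotent (augmentationRep Γ')).choose_spec

/-- The idempotent `e₁' = |Γ'|⁻¹ ∑_{τ ∈ Γ'} τ` of `ℚ[Γ]`. -/
def unitIdem (Γ' : Subgroup Γ) : ℚ[Γ] :=
  (Nat.card Γ' : ℚ)⁻¹ • ∑ᶠ τ : Γ', MonoidAlgebra.of ℚ Γ (τ : Γ)

/-- The algebra `f ℚ[Γ] f` with `f = e₁' e_{Γ/Γ'}` is `e₁' e_{Γ/Γ'} ℚ[Γ] e₁'`. -/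
theorem mem_corner_iff [Finite Γ] (Γ' : Subgroup Γ) (y : ℚ[Γ]) :
    y ∈ corner (unitIdem Γ' * augIdem Γ') ↔
      ∃ x : ℚ[Γ], unitIdem Γ' * augIdem Γ' * x * unitIdem Γ' = y := by
  have h := augIdem_spec Γ'
  have key : ∀ x : ℚ[Γ], unitIdem Γ' * augIdem Γ' * (x * (unitIdem Γ' * augIdem Γ')) =
      unitIdem Γ' * augIdem Γ' * x * unitIdem Γ' := fun x => by
    rw [← h.central (unitIdem Γ'), ← mul_assoc x, ← h.central x, mul_assoc (augIdem Γ') x,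
      h.central (unitIdem Γ'), mul_assoc (unitIdem Γ'), ← mul_assoc (augIdem Γ'), h.idem]
    simp only [mul_assoc]
  simp only [corner, LinearMap.mem_range, LinearMap.comp_apply, LinearMap.mulLeft_apply,
    LinearMap.mulRight_apply, key]

end Idempotents

section Lattices

variable {Γ : Type*} [Group Γ]

/-- The group ring `ℤ_S[Γ]` inside `ℚ[Γ]`. -/
def groupRing (S : Set Nat.Primes) (Γ : Type*) [Group Γ] : Submodule (ZS S) ℚ[Γ] where
  carrier := {x | ∀ g, x.coeff g ∈ ZS S}
  add_mem' {x y} hx hy g := by simpa using add_mem (hx g) (hy g)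
  zero_mem' g := by simp [zero_mem]
  smul_mem' c x hx g := by simpa [Subring.smul_def] using mul_mem c.2 (hx g)

/-- The prime `p` is good for the central idempotent `e` of `ℚ[Γ]`: `e ∈ ℤ_(p)[Γ]` and `e ℤ_(p)[Γ]`
is a maximal `ℤ_(p)`-order in `e ℚ[Γ]`. -/
def IsGoodPrime (p : Nat.Primes) (e : ℚ[Γ]) : Prop :=
  e ∈ groupRing {p} Γ ∧
    IsMaximalOrder (ZS {p}) e ((groupRing {p} Γ).map (LinearMap.mulLeft (ZS {p}) e))

/-- The elements of `M ⊆ ℚ[Γ]` that are fixed by left multiplication by the elements of `Γ'`. -/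
def leftInvariants {R : Subring ℚ} (Γ' : Subgroup Γ) (M : Submodule R ℚ[Γ]) :
    Submodule R ℚ[Γ] where
  carrier := {x | x ∈ M ∧ ∀ τ ∈ Γ', MonoidAlgebra.of ℚ Γ τ * x = x}
  add_mem' {x y} hx hy := ⟨add_mem hx.1 hy.1, fun τ hτ => by rw [mul_add, hx.2 τ hτ, hy.2 τ hτ]⟩
  zero_mem' := ⟨zero_mem _, fun τ _ => mul_zero _⟩
  smul_mem' c x hx := ⟨M.smul_mem c hx.1, fun τ hτ => by rw [mul_smul_comm, hx.2 τ hτ]⟩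

/-- The order `𝔬 = ^{Γ'}(e_{Γ/Γ'} 𝒪 e₁')`. -/
def heckeOrder [Finite Γ] {R : Subring ℚ} (Γ' : Subgroup Γ) (O : Submodule R ℚ[Γ]) :
    Submodule R ℚ[Γ] :=
  leftInvariants Γ'
    (O.map (LinearMap.mulLeft R (augIdem Γ') ∘ₗ LinearMap.mulRight R (unitIdem Γ')))

end Lattices

end HeckeOrder

end

namespace HeckeOrder

/-! Write `e` for `augIdem Γ'`, `u` for `unitIdem Γ'`, `G` for `ℤ_S[Γ]`, and let `Λ` be an order
containing `𝔬`. The idea is to induce `Λ` up to an order of `e ℚ[Γ]`, where goodness of the primes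
in `S` bounds it. With `M = G ∩ u e ℚ[Γ]` one has `M G ⊆ M`, and `M Λ ⊆ Λ` because `M u ⊆ 𝔬`
(`dualLattice_mul_le`). Hence `e G + G Λ M` is an order of `e ℚ[Γ]` (`isOrder_induced`). It contains
`e G`, so local maximality at each `p ∈ S` forces it into `G` (`IsOrder.le_groupRing`). For `x ∈ Λ`,
the element `|Γ'| x = x (|Γ'| u e)` lies in `G Λ M ⊆ G`. It is right `Γ'`-invariant, so it equals `w
(|Γ'| u)` with `w ∈ G` (`exists_mul_card_smul_unitIdem`). Cancelling `|Γ'|` gives `x = w u = e w u ∈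
𝔬`. -/

instance (S : Set Nat.Primes) : IsNoetherianRing (ZS S) := by
  -- The submonoid consists of all integers that become units, so it suffices that reduced
  -- denominators are invertible.
  have hloc : IsLocalization ((IsUnit.submonoid (ZS S)).comap (algebraMap ℤ (ZS S))) (ZS S) := by
    refine ⟨fun y => y.2, fun q => ?_, fun h => ⟨1, by simp_all⟩⟩
    have hd : IsUnit (algebraMap ℤ (ZS S) (q : ℚ).den) := by
      have hmem : ((q : ℚ).den : ℚ)⁻¹ ∈ ZS S := fun p hp => by
        rw [Rat.inv_natCast_den_of_pos (q : ℚ).den_pos]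
        exact q.2 p hp
      refine .of_mul_eq_one ⟨_, hmem⟩ (Subtype.ext ?_)
      simp
    refine ⟨((q : ℚ).num, ⟨_, hd⟩), Subtype.ext ?_⟩
    simp
  exact IsLocalization.isNoetherianRing ((IsUnit.submonoid (ZS S)).comap (algebraMap ℤ (ZS S))) _
    inferInstance

theorem ZS_anti {S T : Set Nat.Primes} (h : T ⊆ S) : ZS S ≤ ZS T :=
  fun _ hq p hp => hq p (h hp)

/-! ### Corner algebras and extension of scalars for orders -/

section Corner

variable {A : Type*} [Ring A] [Algebra ℚ A] {f x : A}

theorem mem_corner_iff_of_idem (hf : f * f = f) : x ∈ corner f ↔ f * x = x ∧ x * f = x := by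
  simp only [corner, LinearMap.mem_range, LinearMap.comp_apply, LinearMap.mulLeft_apply,
    LinearMap.mulRight_apply]
  constructor
  · rintro ⟨y, rfl⟩
    constructor
    · rw [← mul_assoc, hf]
    · rw [mul_assoc, mul_assoc, hf]
  · rintro ⟨h1, h2⟩
    exact ⟨x, by rw [h2, h1]⟩

theorem corner_one : corner (1 : A) = ⊤ :=
  eq_top_iff.2 fun x _ => (mem_corner_iff_of_idem (one_mul 1)).2 ⟨one_mul x, mul_one x⟩

/-- Extending scalars in an order from `R` to a larger ring of coefficients. -/
theorem IsOrder.span {R R' : Subring ℚ} (hR : R ≤ R') {Λ : Submodule R A} (h : IsOrder R f Λ) :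
    IsOrder R' f (Submodule.span R' (Λ : Set A)) where
  le_corner x hx := by
    have : Submodule.span R' (Λ : Set A) ≤ (corner f).restrictScalars R' :=
      Submodule.span_le.2 h.le_corner
    exact this hx
  one_mem := Submodule.subset_span h.one_mem
  mul_mem x hx y hy := by
    have := Submodule.mul_mem_mul hx hy
    rw [Submodule.span_mul_span] at this
    refine Submodule.span_mono ?_ this
    rintro _ ⟨a, ha, b, hb, rfl⟩
    exact h.mul_mem a ha b hb
  fg := by
    obtain ⟨T, hT⟩ := h.fg
    refine ⟨T, le_antisymm (Submodule.span_mono ?_) (Submodule.span_le.2 fun x hx => ?_)⟩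
    · rw [← hT]; exact Submodule.subset_span
    · rw [← hT] at hx
      induction hx using Submodule.span_induction with
      | mem x hx => exact Submodule.subset_span hx
      | zero => exact zero_mem _
      | add x y _ _ hx hy => exact add_mem hx hy
      | smul c x _ hx => exact Submodule.smul_mem _ (⟨c, hR c.2⟩ : R') hx
  span_eq := by rw [Submodule.span_span_of_tower, h.span_eq]

end Corner

/-! ### The group ring and good primes -/

section GroupRing

variable {Γ : Type*} [Group Γ] {S : Set Nat.Primes}

theorem mem_groupRing_of_forall_singleton {x : ℚ[Γ]} (h : ∀ p ∈ S, x ∈ groupRing {p} Γ) :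
    x ∈ groupRing S Γ :=
  fun g p hp => h p hp g p rfl

theorem groupRing_eq_span [Finite Γ] :
    groupRing S Γ = Submodule.span (ZS S) (Set.range (MonoidAlgebra.of ℚ Γ)) := by
  refine le_antisymm (fun x hx => ?_) (Submodule.span_le.2 ?_)
  · rw [← MonoidAlgebra.sum_coeff_single x]
    refine Submodule.sum_mem _ fun g _ => ?_
    have : MonoidAlgebra.single g (x.coeff g) =
        (⟨x.coeff g, hx g⟩ : ZS S) • MonoidAlgebra.of ℚ Γ g := by
      simp [Subring.smul_def]
    rw [this]
    exact Submodule.smul_mem _ _ (Submodule.subset_span ⟨g, rfl⟩)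
  · rintro _ ⟨g, rfl⟩ h
    classical
    rw [MonoidAlgebra.of_apply, MonoidAlgebra.coeff_single, Finsupp.single_apply]
    split_ifs
    exacts [one_mem _, zero_mem _]

variable [Finite Γ]

theorem of_mem_groupRing (g : Γ) : MonoidAlgebra.of ℚ Γ g ∈ groupRing S Γ := by
  rw [groupRing_eq_span]; exact Submodule.subset_span ⟨g, rfl⟩

theorem one_mem_groupRing : (1 : ℚ[Γ]) ∈ groupRing S Γ := by
  rw [← map_one (MonoidAlgebra.of ℚ Γ)]; exact of_mem_groupRing 1

theorem groupRing_mul_le : groupRing S Γ * groupRing S Γ ≤ groupRing S Γ := by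
  rw [groupRing_eq_span, Submodule.span_mul_span]
  refine Submodule.span_mono ?_
  rintro _ ⟨_, ⟨g, rfl⟩, _, ⟨h, rfl⟩, rfl⟩
  exact ⟨g * h, map_mul _ _ _⟩

theorem mul_mem_groupRing {x y : ℚ[Γ]} (hx : x ∈ groupRing S Γ) (hy : y ∈ groupRing S Γ) :
    x * y ∈ groupRing S Γ :=
  groupRing_mul_le (Submodule.mul_mem_mul hx hy)

theorem groupRing_fg : (groupRing S Γ).FG := by
  rw [groupRing_eq_span]
  exact Submodule.fg_span (Set.finite_range _)

/-- If all primes in `S` are good for `e`, then every order of `e ℚ[Γ]` that contains `e ℤ_S[Γ]`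
lies in the group ring. -/
theorem IsOrder.le_groupRing {e : ℚ[Γ]} (hS : ∀ p ∈ S, IsGoodPrime p e)
    {Λ : Submodule (ZS S) ℚ[Γ]} (hΛ : IsOrder (ZS S) e Λ)
    (hle : ∀ x ∈ groupRing S Γ, e * x ∈ Λ) : Λ ≤ groupRing S Γ := by
  refine fun x hx => mem_groupRing_of_forall_singleton fun p hp => ?_
  obtain ⟨he, hmax⟩ := hS p hp
  -- Over `ℤ_(p)` the extended order contains `e ℤ_(p)[Γ]`, hence equals it by maximality.
  have hspan := hmax.maximal _ (hΛ.span (ZS_anti (Set.singleton_subset_iff.2 hp))) (by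
    rw [groupRing_eq_span, Submodule.map_span_le]
    rintro _ ⟨g, rfl⟩
    exact Submodule.subset_span (hle _ (of_mem_groupRing g)))
  obtain ⟨y, hy, rfl⟩ : x ∈ (groupRing {p} Γ).map (LinearMap.mulLeft (ZS {p}) e) :=
    hspan ▸ Submodule.subset_span hx
  exact mul_mem_groupRing he hy

end GroupRing

/-! ### The averaging idempotent and `Γ'`-invariants -/

section UnitIdem

variable {Γ : Type*} [Group Γ] [Finite Γ] {S : Set Nat.Primes} (Γ' : Subgroup Γ)

theorem card_smul_unitIdem :
    (Nat.card Γ' : ℚ) • unitIdem Γ' = ∑ᶠ τ : Γ', MonoidAlgebra.of ℚ Γ (τ : Γ) := by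
  rw [unitIdem, smul_inv_smul₀ (Nat.cast_ne_zero.2 Nat.card_pos.ne')]

theorem card_smul_unitIdem_mem : (Nat.card Γ' : ℚ) • unitIdem Γ' ∈ groupRing S Γ := by
  have := Fintype.ofFinite Γ'
  rw [card_smul_unitIdem, finsum_eq_sum_of_fintype]
  exact sum_mem fun τ _ => of_mem_groupRing _

variable {Γ'}

theorem of_mul_unitIdem {τ : Γ} (hτ : τ ∈ Γ') :
    MonoidAlgebra.of ℚ Γ τ * unitIdem Γ' = unitIdem Γ' := by
  have := Fintype.ofFinite Γ'
  rw [unitIdem, mul_smul_comm, finsum_eq_sum_of_fintype, Finset.mul_sum]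
  congr 1
  exact Fintype.sum_equiv (Equiv.mulLeft ⟨τ, hτ⟩) _ _ fun σ => by simp

theorem unitIdem_mul_of {τ : Γ} (hτ : τ ∈ Γ') :
    unitIdem Γ' * MonoidAlgebra.of ℚ Γ τ = unitIdem Γ' := by
  have := Fintype.ofFinite Γ'
  rw [unitIdem, smul_mul_assoc, finsum_eq_sum_of_fintype, Finset.sum_mul]
  congr 1
  exact Fintype.sum_equiv (Equiv.mulRight ⟨τ, hτ⟩) _ _ fun σ => by simp

theorem unitIdem_mul_of_invariant {x : ℚ[Γ]} (hx : ∀ τ ∈ Γ', MonoidAlgebra.of ℚ Γ τ * x = x) :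
    unitIdem Γ' * x = x := by
  have := Fintype.ofFinite Γ'
  rw [unitIdem, smul_mul_assoc, finsum_eq_sum_of_fintype, Finset.sum_mul,
    Finset.sum_congr rfl fun (τ : Γ') _ => hx τ τ.2, Finset.sum_const, Finset.card_univ,
    ← Nat.card_eq_fintype_card, ← Nat.cast_smul_eq_nsmul ℚ,
    inv_smul_smul₀ (Nat.cast_ne_zero.2 Nat.card_pos.ne')]

theorem unitIdem_idem : unitIdem Γ' * unitIdem Γ' = unitIdem Γ' :=
  unitIdem_mul_of_invariant fun _ => of_mul_unitIdem

/-- A right `Γ'`-invariant element of `ℤ_S[Γ]` is a multiple of the sum of the elements of `Γ'`. -/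
theorem exists_mul_card_smul_unitIdem {z : ℚ[Γ]} (hz : z ∈ groupRing S Γ)
    (hinv : z * unitIdem Γ' = z) :
    ∃ w ∈ groupRing S Γ, w * ((Nat.card Γ' : ℚ) • unitIdem Γ') = z := by
  classical
  have := Fintype.ofFinite Γ'
  have := Fintype.ofFinite (Γ ⧸ Γ')
  have hconst (g : Γ) (τ : Γ) (hτ : τ ∈ Γ') : z.coeff (g * τ) = z.coeff g := by
    have h : z * MonoidAlgebra.of ℚ Γ τ = z := by rw [← hinv, mul_assoc, unitIdem_mul_of hτ]
    conv_lhs => rw [← h]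
    simp [MonoidAlgebra.of_apply]
  -- The coefficients of `z` are constant on left cosets of `Γ'`; `w` keeps one representative of
  -- each.
  refine ⟨∑ c : Γ ⧸ Γ', MonoidAlgebra.single c.out (z.coeff c.out), sum_mem fun c _ g => ?_, ?_⟩
  · rw [MonoidAlgebra.coeff_single, Finsupp.single_apply]
    split_ifs
    exacts [hz _, zero_mem _]
  · rw [card_smul_unitIdem, finsum_eq_sum_of_fintype]
    ext h
    simp only [Finset.sum_mul, Finset.mul_sum, MonoidAlgebra.of_apply,
      MonoidAlgebra.single_mul_single, MonoidAlgebra.coeff_sum, Finsupp.finsetSum_apply,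
      MonoidAlgebra.coeff_single, Finsupp.single_apply, mul_one]
    have hmem : (h : Γ ⧸ Γ').out⁻¹ * h ∈ Γ' := QuotientGroup.eq.1 (QuotientGroup.out_eq' _)
    rw [Finset.sum_comm, Finset.sum_eq_single (h : Γ ⧸ Γ'), Finset.sum_eq_single ⟨_, hmem⟩]
    · rw [if_pos (mul_inv_cancel_left _ _), ← hconst _ _ hmem, mul_inv_cancel_left]
    · exact fun τ _ hτ => if_neg fun h' => hτ (Subtype.ext (eq_inv_mul_of_mul_eq h'))
    · simp
    · refine fun c _ hc => Finset.sum_eq_zero fun τ _ => if_neg fun h' => hc ?_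
      rw [← h', QuotientGroup.mk_mul_of_mem _ τ.2, QuotientGroup.out_eq']
    · simp

end UnitIdem

/-! ### The order `𝔬` and the induced order -/

section HeckeOrder

variable {Γ : Type*} [Group Γ] [Finite Γ] {S : Set Nat.Primes} {Γ' : Subgroup Γ}

theorem augIdem_mul_unitIdem : augIdem Γ' * unitIdem Γ' = unitIdem Γ' * augIdem Γ' :=
  (augIdem_spec Γ').central _

theorem unitIdem_mul_augIdem_idem :
    unitIdem Γ' * augIdem Γ' * (unitIdem Γ' * augIdem Γ') = unitIdem Γ' * augIdem Γ' := by
  rw [mul_assoc, ← mul_assoc (augIdem Γ'), augIdem_mul_unitIdem, mul_assoc (unitIdem Γ'),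
    (augIdem_spec Γ').idem, ← mul_assoc, unitIdem_idem]

theorem augIdem_mem_groupRing (hS : ∀ p ∈ S, IsGoodPrime p (augIdem Γ')) :
    augIdem Γ' ∈ groupRing S Γ :=
  mem_groupRing_of_forall_singleton fun p hp => (hS p hp).1

theorem mem_heckeOrder_iff {R : Subring ℚ} {O : Submodule R ℚ[Γ]} {x : ℚ[Γ]} :
    x ∈ heckeOrder Γ' O ↔
      (∃ y ∈ O, augIdem Γ' * (y * unitIdem Γ') = x) ∧ unitIdem Γ' * x = x := by
  refine and_congr Iff.rfl ⟨unitIdem_mul_of_invariant, fun hx τ hτ => ?_⟩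
  rw [← hx, ← mul_assoc, of_mul_unitIdem hτ]

theorem heckeOrder_le_corner {R : Subring ℚ} {O : Submodule R ℚ[Γ]} {x : ℚ[Γ]}
    (hx : x ∈ heckeOrder Γ' O) : x ∈ corner (unitIdem Γ' * augIdem Γ') := by
  obtain ⟨⟨y, -, rfl⟩, h⟩ := mem_heckeOrder_iff.1 hx
  refine (mem_corner_iff_of_idem unitIdem_mul_augIdem_idem).2 ⟨?_, ?_⟩
  · rw [mul_assoc, ← mul_assoc (augIdem Γ'), (augIdem_spec Γ').idem, h]
  · rw [← mul_assoc, mul_assoc _ _ (unitIdem Γ'), mul_assoc y, unitIdem_idem,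
      ← (augIdem_spec Γ').central, ← mul_assoc, (augIdem_spec Γ').idem]

/-- `𝔬` is an order as soon as `𝒪` is an order containing `ℤ_S[Γ]` and `e_{Γ/Γ'}`. -/
theorem isOrder_heckeOrder {O : Submodule (ZS S) ℚ[Γ]} (hO : IsOrder (ZS S) 1 O)
    (hΓO : groupRing S Γ ≤ O) (he : augIdem Γ' ∈ O) :
    IsOrder (ZS S) (unitIdem Γ' * augIdem Γ') (heckeOrder Γ' O) where
  le_corner _ := heckeOrder_le_corner
  one_mem := mem_heckeOrder_iff.2
    ⟨⟨1, hO.one_mem, by rw [one_mul, augIdem_mul_unitIdem]⟩, by rw [← mul_assoc, unitIdem_idem]⟩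
  mul_mem x hx y hy := by
    obtain ⟨⟨a, ha, rfl⟩, hx⟩ := mem_heckeOrder_iff.1 hx
    obtain ⟨⟨b, hb, hb'⟩, hy⟩ := mem_heckeOrder_iff.1 hy
    refine mem_heckeOrder_iff.2
      ⟨⟨a * (augIdem Γ' * b), hO.mul_mem _ ha _ (hO.mul_mem _ he _ hb), ?_⟩, ?_⟩
    · rw [mul_assoc (augIdem Γ'), mul_assoc a (unitIdem Γ'), hy, ← hb']
      simp only [mul_assoc]
    · rw [← mul_assoc, hx]
  fg := by
    have := isNoetherian_of_fg_of_noetherian _ (hO.fg.map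
      (LinearMap.mulLeft (ZS S) (augIdem Γ') ∘ₗ LinearMap.mulRight (ZS S) (unitIdem Γ')))
    exact Submodule.FG.of_le
      (hO.fg.map (LinearMap.mulLeft (ZS S) (augIdem Γ') ∘ₗ LinearMap.mulRight (ZS S) (unitIdem Γ')))
      fun _ h => h.1
  span_eq := by
    refine le_antisymm (Submodule.span_le.2 fun _ => heckeOrder_le_corner) ?_
    rintro _ ⟨x, rfl⟩
    have hx : x ∈ Submodule.span ℚ (O : Set ℚ[Γ]) := by
      rw [hO.span_eq, corner_one]; trivial
    induction hx using Submodule.span_induction with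
    | mem x hx =>
      -- Since `u` itself need not lie in `O`, the denominator is cleared by `|Γ'|`, which is
      -- harmless in a `ℚ`-span.
      have hc : (Nat.card Γ' : ℚ) ≠ 0 := Nat.cast_ne_zero.2 Nat.card_pos.ne'
      rw [← Submodule.smul_mem_iff _ hc]
      refine Submodule.subset_span (mem_heckeOrder_iff.2
        ⟨⟨(Nat.card Γ' : ℚ) • unitIdem Γ' * x,
          hO.mul_mem _ (hΓO (card_smul_unitIdem_mem Γ')) _ hx, ?_⟩, ?_⟩)
      · have h : unitIdem Γ' * augIdem Γ' * (x * (unitIdem Γ' * augIdem Γ')) =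
            augIdem Γ' * (unitIdem Γ' * x * unitIdem Γ') := by
          rw [← augIdem_mul_unitIdem, ← mul_assoc x, mul_assoc (augIdem Γ'),
            ← (augIdem_spec Γ').central x]
          simp only [mul_assoc]
          rw [← mul_assoc (unitIdem Γ') (augIdem Γ'), ← augIdem_mul_unitIdem,
            mul_assoc (augIdem Γ') (unitIdem Γ'), ← mul_assoc (augIdem Γ') (augIdem Γ'),
            (augIdem_spec Γ').idem]
        simp only [LinearMap.comp_apply, LinearMap.mulLeft_apply, LinearMap.mulRight_apply, h]
        simp only [smul_mul_assoc, mul_smul_comm]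
      · simp only [LinearMap.comp_apply, LinearMap.mulLeft_apply, LinearMap.mulRight_apply,
          mul_smul_comm, ← mul_assoc, unitIdem_idem]
    | zero => simp
    | add x y _ _ hx hy => rw [map_add]; exact add_mem hx hy
    | smul c x _ hx => rw [map_smul]; exact Submodule.smul_mem _ _ hx

/-- The elements of `e₁' e_{Γ/Γ'} ℚ[Γ]` in the group ring: the dual lattice of
`e_{Γ/Γ'} ℤ_S[Γ] e₁'`. -/
noncomputable def dualLattice (S : Set Nat.Primes) (Γ' : Subgroup Γ) : Submodule (ZS S) ℚ[Γ] :=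
  groupRing S Γ ⊓ LinearMap.eqLocus (LinearMap.mulLeft (ZS S) (unitIdem Γ' * augIdem Γ'))
    LinearMap.id

theorem mem_dualLattice {x : ℚ[Γ]} :
    x ∈ dualLattice S Γ' ↔ x ∈ groupRing S Γ ∧ unitIdem Γ' * augIdem Γ' * x = x :=
  Iff.rfl

theorem dualLattice_mul_groupRing_le :
    dualLattice S Γ' * groupRing S Γ ≤ dualLattice S Γ' :=
  Submodule.mul_le.2 fun _ hm _ hg =>
    mem_dualLattice.2 ⟨mul_mem_groupRing hm.1 hg, by rw [← mul_assoc, (mem_dualLattice.1 hm).2]⟩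

theorem augIdem_mul_of_mem_dualLattice {x : ℚ[Γ]} (hx : x ∈ dualLattice S Γ') :
    augIdem Γ' * x = x := by
  rw [← (mem_dualLattice.1 hx).2, ← augIdem_mul_unitIdem, ← mul_assoc, ← mul_assoc,
    (augIdem_spec Γ').idem]

/-- Since `x = u x`, one has `m x = (m u) x`, and `m u = e m u` is left `Γ'`-invariant, hence in `𝔬
⊆ Λ`. -/
theorem dualLattice_mul_le {O Λ : Submodule (ZS S) ℚ[Γ]} (hΓO : groupRing S Γ ≤ O)
    (hΛ : IsOrder (ZS S) (unitIdem Γ' * augIdem Γ') Λ) (hle : heckeOrder Γ' O ≤ Λ) :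
    dualLattice S Γ' * Λ ≤ Λ := by
  refine Submodule.mul_le.2 fun m hm x hx => ?_
  have hx' := ((mem_corner_iff_of_idem unitIdem_mul_augIdem_idem).1 (hΛ.le_corner x hx)).1
  have hx1 : unitIdem Γ' * x = x := by
    rw [← hx', ← mul_assoc, ← mul_assoc, unitIdem_idem]
  rw [← hx1, ← mul_assoc]
  refine hΛ.mul_mem _ (hle (mem_heckeOrder_iff.2 ⟨⟨m, hΓO hm.1, ?_⟩, ?_⟩)) _ hx
  · rw [← mul_assoc, augIdem_mul_of_mem_dualLattice hm]
  · rw [← (mem_dualLattice.1 hm).2]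
    simp only [← mul_assoc, unitIdem_idem]

/-- The order of `e_{Γ/Γ'} ℚ[Γ]` induced by an order `Λ ⊇ 𝔬` of `e₁' e_{Γ/Γ'} ℚ[Γ] e₁'`. -/
theorem isOrder_induced (he : augIdem Γ' ∈ groupRing S Γ) {O Λ : Submodule (ZS S) ℚ[Γ]}
    (hΓO : groupRing S Γ ≤ O)
    (hΛ : IsOrder (ZS S) (unitIdem Γ' * augIdem Γ') Λ) (hle : heckeOrder Γ' O ≤ Λ) :
    IsOrder (ZS S) (augIdem Γ')
      ((groupRing S Γ).map (LinearMap.mulLeft (ZS S) (augIdem Γ')) ⊔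
        groupRing S Γ * Λ * dualLattice S Γ') := by
  have h := augIdem_spec Γ'
  set G := groupRing S Γ
  set M := dualLattice S Γ'
  set E := G.map (LinearMap.mulLeft (ZS S) (augIdem Γ'))
  have hEG : E ≤ G := by
    rintro _ ⟨g, hg, rfl⟩
    exact mul_mem_groupRing he hg
  have hΛΛ : Λ * Λ ≤ Λ := Submodule.mul_le.2 hΛ.mul_mem
  have hMΛ : M * Λ ≤ Λ := dualLattice_mul_le hΓO hΛ hle
  have hGG : G * G ≤ G := groupRing_mul_le
  have hMG : M * G ≤ M := dualLattice_mul_groupRing_le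
  have hmem : ∀ x ∈ E ⊔ G * Λ * M, augIdem Γ' * x = x := by
    intro x hx
    have : E ⊔ G * Λ * M ≤
        LinearMap.eqLocus (LinearMap.mulLeft (ZS S) (augIdem Γ')) LinearMap.id := by
      refine sup_le ?_ (Submodule.mul_le.2 fun y _ m hm => ?_)
      · rintro _ ⟨g, -, rfl⟩
        simp [← mul_assoc, h.idem]
      · simp only [LinearMap.mem_eqLocus, LinearMap.mulLeft_apply, LinearMap.id_apply]
        rw [← mul_assoc, h.central, mul_assoc, augIdem_mul_of_mem_dualLattice hm]
    exact this hx
  have hcorner : ∀ x ∈ E ⊔ G * Λ * M, x ∈ corner (augIdem Γ') := fun x hx =>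
    (mem_corner_iff_of_idem h.idem).2 ⟨hmem x hx, by rw [← h.central, hmem x hx]⟩
  have hone : augIdem Γ' ∈ E := ⟨1, one_mem_groupRing, mul_one _⟩
  have hEE : E * E ≤ E := by
    refine Submodule.mul_le.2 ?_
    rintro _ ⟨g, hg, rfl⟩ y hy
    refine ⟨g * y, mul_mem_groupRing hg (hEG hy), ?_⟩
    simp only [LinearMap.mulLeft_apply, mul_assoc]
  -- The summand `E` supplies the identity; the other one absorbs products through `G G ⊆ G`, `M G ⊆
  -- M`, `M Λ ⊆ Λ` and `Λ Λ ⊆ Λ`.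
  have hmul : (E ⊔ G * Λ * M) * (E ⊔ G * Λ * M) ≤ E ⊔ G * Λ * M := by
    rw [Submodule.sup_mul, Submodule.mul_sup, Submodule.mul_sup]
    refine sup_le (sup_le (hEE.trans le_sup_left) ?_) (sup_le ?_ ?_) <;>
      refine le_trans ?_ (le_sup_right (a := E))
    · calc E * (G * Λ * M) ≤ G * (G * Λ * M) := by gcongr
        _ = G * G * Λ * M := by simp only [mul_assoc]
        _ ≤ G * Λ * M := by gcongr
    · calc G * Λ * M * E ≤ G * Λ * M * G := by gcongr
        _ = G * Λ * (M * G) := by simp only [mul_assoc]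
        _ ≤ G * Λ * M := by gcongr
    · calc G * Λ * M * (G * Λ * M) = G * Λ * (M * G) * Λ * M := by simp only [mul_assoc]
        _ ≤ G * Λ * M * Λ * M := by gcongr
        _ = G * (Λ * (M * Λ)) * M := by simp only [mul_assoc]
        _ ≤ G * (Λ * Λ) * M := by gcongr
        _ ≤ G * Λ * M := by gcongr
  have := isNoetherian_of_fg_of_noetherian _ (groupRing_fg (S := S) (Γ := Γ))
  refine ⟨hcorner, le_sup_left (a := E) hone,
    fun x hx y hy => hmul (Submodule.mul_mem_mul hx hy),
    (groupRing_fg.map _).sup ((groupRing_fg.mul hΛ.fg).mul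
      (Submodule.FG.of_le groupRing_fg inf_le_left)),
    le_antisymm (Submodule.span_le.2 hcorner) fun x hx => ?_⟩
  -- The elements `e g` of `E` already span `e ℚ[Γ]`.
  rw [← ((mem_corner_iff_of_idem h.idem).1 hx).1, ← MonoidAlgebra.sum_coeff_single x,
    Finsupp.sum, Finset.mul_sum]
  refine Submodule.sum_mem _ fun g _ => ?_
  have hg : MonoidAlgebra.single g (x.coeff g) = x.coeff g • MonoidAlgebra.of ℚ Γ g := by simp
  rw [hg, mul_smul_comm]
  exact Submodule.smul_mem _ _ (Submodule.subset_span
    (le_sup_left (a := E) ⟨_, of_mem_groupRing g, rfl⟩))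

end HeckeOrder

end HeckeOrder

open HeckeOrder in
theorem mainTheorem9 {Γ : Type*} [Group Γ] [Finite Γ] (Γ' : Subgroup Γ) (S : Set Nat.Primes)
    (hS : ∀ p ∈ S, HeckeOrder.IsGoodPrime p (HeckeOrder.augIdem Γ'))
    (O : Submodule (HeckeOrder.ZS S) ℚ[Γ])
    (hO : HeckeOrder.IsMaximalOrder (HeckeOrder.ZS S) (1 : ℚ[Γ]) O)
    (hΓO : HeckeOrder.groupRing S Γ ≤ O) :
    HeckeOrder.IsMaximalOrder (HeckeOrder.ZS S)
      (HeckeOrder.unitIdem Γ' * HeckeOrder.augIdem Γ') (HeckeOrder.heckeOrder Γ' O) := by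
  have he : augIdem Γ' ∈ groupRing S Γ := augIdem_mem_groupRing hS
  refine ⟨isOrder_heckeOrder hO.isOrder hΓO (hΓO he), fun Λ hΛ hle =>
    le_antisymm (fun x hx => ?_) hle⟩
  have hx' := (mem_corner_iff_of_idem unitIdem_mul_augIdem_idem).1 (hΛ.le_corner x hx)
  have hx1 : unitIdem Γ' * x = x := by rw [← hx'.1, ← mul_assoc, ← mul_assoc, unitIdem_idem]
  have hxe : x * augIdem Γ' = x := by
    rw [← hx'.2, mul_assoc, mul_assoc, (augIdem_spec Γ').idem]
  have hxu : x * unitIdem Γ' = x := by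
    rw [← hx'.2, mul_assoc, ← augIdem_mul_unitIdem, mul_assoc, unitIdem_idem]
  -- This element of `M` acts on `Λ` from the right as the scalar `|Γ'|`.
  have hM : (Nat.card Γ' : ℚ) • unitIdem Γ' * augIdem Γ' ∈ dualLattice S Γ' := by
    refine mem_dualLattice.2 ⟨mul_mem_groupRing (card_smul_unitIdem_mem Γ') he, ?_⟩
    rw [smul_mul_assoc, mul_smul_comm, unitIdem_mul_augIdem_idem]
  have hz := (isOrder_induced he hΓO hΛ hle).le_groupRing hS
    (fun y hy => Submodule.mem_sup_left ⟨y, hy, rfl⟩)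
    (Submodule.mem_sup_right
      (Submodule.mul_mem_mul (Submodule.mul_mem_mul one_mem_groupRing hx) hM))
  have hxz : 1 * x * ((Nat.card Γ' : ℚ) • unitIdem Γ' * augIdem Γ') = (Nat.card Γ' : ℚ) • x := by
    rw [smul_mul_assoc, mul_smul_comm, one_mul, hx'.2]
  rw [hxz] at hz
  -- Right invariance returns exactly the factor `|Γ'|` lost in passing from `Λ` to `G`.
  obtain ⟨w, hw, hwz⟩ := exists_mul_card_smul_unitIdem (Γ' := Γ') hz (by rw [smul_mul_assoc, hxu])
  rw [mul_smul_comm] at hwz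
  have hwx := smul_right_injective _
    (Nat.cast_ne_zero.2 Nat.card_pos.ne' : (Nat.card Γ' : ℚ) ≠ 0) hwz
  refine mem_heckeOrder_iff.2 ⟨⟨w, hΓO hw, ?_⟩, hx1⟩
  rw [hwx, (augIdem_spec Γ').central, hxe]
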